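/- For each $n\ge 1$ let $d=d_n\ge 1$ be an integer and $\sigma=\sigma_n>0$ a real number, and suppose that $d_n=o(\log n)$ as $n\to\infty$. Let $\pi^\star$ be a uniformly random permutation of $\{1,\dots,n\}$, let $X_1,\dots,X_n$ be i.i.d. $\mathcal N(0,I_d)$ and $Z_1,\dots,Z_n$ be i.i.d. $\mathcal N(0,\sigma^2 I_d)$ random vectors in $\mathbb R^d$, with $\pi^\star$, $(X_i)_i$, $(Z_i)_i$ independent, and put $$Y_i = X_{\pi^\star(i)}+Z_i,\qquad i=1,\dots,n .$$ An estimator $\hat\pi$ is a measurable map that takes $(X_1,\dots,X_n)$ and $(Y_1,\dots,Y_n)$ to a permutation of $\{1,\dots,n\}$, and $d_H(\hat\pi,\pi^\star)=\sum_{j=1}^n \mathbf 1\{\hat\pi(j)\ne\pi^\star(j)\}$. Then, as $n\to\infty$, $$\inf_{\hat\pi}\mathbb E\big[d_H(\hat\pi,\pi^\star)\big] = \big(n^{2+o(1)}\sigma^d\big)\wedge n^{1+o(1)},$$ where the infimum is over all estimators; that is, there are real sequences $a_n\to0$ and $b_n\to0$ such that, for all sufficiently large $n$, $\inf_{\hat\pi}\mathbb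 E[d_H(\hat\pi,\pi^\star)]=\min\{n^{2+a_n}\sigma_n^{d_n},\,n^{1+b_n}\}$. -/

import Mathlib

open MeasureTheory ProbabilityTheory Filter Topology Asymptotics

/-- The finite set of permutations of `Fin n` carries the discrete σ-algebra. -/
instance permMeasurableSpace (n : ℕ) : MeasurableSpace (Equiv.Perm (Fin n)) := ⊤

/-- `n` labelled points in Euclidean space `ℝ^d`. -/
abbrev PointConfig (n d : ℕ) : Type := Fin n → EuclideanSpace ℝ (Fin d)

/-- An estimator: a measurable map sending the two observed sequences
`(X_1, …, X_n)` and `(Y_1, …, Y_n)` to a permutation. -/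
structure Estimator (n d : ℕ) where
  toFun : PointConfig n d → PointConfig n d → Equiv.Perm (Fin n)
  measurable_toFun : Measurable (fun p : PointConfig n d × PointConfig n d => toFun p.1 p.2)

/-- The constant estimators show that the infimum over estimators is not over an empty type. -/
instance Estimator.instNonempty (n d : ℕ) : Nonempty (Estimator n d) :=
  ⟨⟨fun _ _ => 1, measurable_const⟩⟩

/-- The joint law of `(π⋆, X, Z)`: `π⋆` is uniform on the permutations of `Fin n`,
`X_1, …, X_n` are i.i.d. with law `P`, `Z_1, …, Z_n` are i.i.d. with law `Q`,
and `π⋆`, `X`, `Z` are independent. -/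
noncomputable def plantedLaw (n : ℕ) {d : ℕ} (P Q : Measure (EuclideanSpace ℝ (Fin d))) :
    Measure (Equiv.Perm (Fin n) × PointConfig n d × PointConfig n d) :=
  (PMF.uniformOfFintype (Equiv.Perm (Fin n))).toMeasure.prod
    ((Measure.pi fun _ => P).prod (Measure.pi fun _ => Q))

/-- The perturbed points `Y_i = X_{π(i)} + Z_i`. -/
def observed {n d : ℕ} (π : Equiv.Perm (Fin n)) (X Z : PointConfig n d) : PointConfig n d :=
  fun i => X (π i) + Z i

/-- The expected number of mistakes `𝔼[d_H(π̂, π⋆)]` of an estimator `π̂ = π̂(X, Y)`, where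
`d_H(π̂, π⋆)` is the number of `j` with `π̂(j) ≠ π⋆(j)`. -/
noncomputable def risk {n d : ℕ} (P Q : Measure (EuclideanSpace ℝ (Fin d)))
    (est : Estimator n d) : ℝ :=
  ∫ ω, (hammingDist (⇑(est.toFun ω.2.1 (observed ω.1 ω.2.1 ω.2.2))) (⇑ω.1) : ℝ)
    ∂(plantedLaw n P Q)

/-- The smallest expected number of mistakes `inf_π̂ 𝔼[d_H(π̂, π⋆)]` over all estimators. -/
noncomputable def minRisk (n : ℕ) {d : ℕ} (P Q : Measure (EuclideanSpace ℝ (Fin d))) : ℝ :=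
  ⨅ est : Estimator n d, risk P Q est

/-- The centred isotropic Gaussian law `𝒩(0, s² I_d)` on `ℝ^d`. -/
noncomputable def isoGaussian (d : ℕ) (s : ℝ) : Measure (EuclideanSpace ℝ (Fin d)) :=
  multivariateGaussian 0 (s ^ 2 • (1 : Matrix (Fin d) (Fin d) ℝ))

/-! The asymptotics follow from a bound at fixed `n` and `d`: up to factors `exp (±20 d)`, the
minimal risk is `min n (n² s^d)`. Since `d = o(log n)`, these factors are `n^(o(1))` and can be
absorbed into the exponents.

Upper bound. The trivial bound is `n`. Otherwise match `Y i` to its nearest point of `X`. A wrong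
point beats the right one with probability at most `(2 s)^d` (`prob_norm_sub_add_le_norm`), by a
Chernoff bound in the noise followed by integration over `X`; a union bound over pairs gives `n² (2
s)^d`. Nearest neighbours need not form a permutation, and `hammingDist_bestMatch_le` repairs this
at the cost of a factor 2.

Lower bound. Given `X` and `Y`, the posterior weight of `π` is proportional to `configPDF s (Y - X ∘
π)`. If `X (π i)` and `X (π j)` are within `s √d` and the noises at `i`, `j` have typical size,
exchanging `i` and `j` keeps a fraction `exp (-3 d)` of the weight (`exp_mul_configPDF_le_swap`). So
no guess for the image of `i` is reliable: the permutations that disagree with it carry comparable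
weight (`mul_sum_swap_weight_le`). Such a `j` exists with probability at least of order `c^d min(1,
n s^d)` (`prob_closePairEvent_ge`); summing over `i` gives the bound. -/

/-! ### Isotropic Gaussian densities. -/

theorem posSemidef_sq_smul_one (d : ℕ) (s : ℝ) :
    (s ^ 2 • (1 : Matrix (Fin d) (Fin d) ℝ)).PosSemidef :=
  Matrix.PosSemidef.one.smul (sq_nonneg s)

instance isoGaussian.instIsProbabilityMeasure (d : ℕ) (s : ℝ) :
    IsProbabilityMeasure (isoGaussian d s) := by
  unfold isoGaussian; infer_instance

/-- The Lebesgue density of `𝒩(0, s² I_d)`. -/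
noncomputable def isoGaussianPDF (d : ℕ) (s : ℝ) (x : EuclideanSpace ℝ (Fin d)) : ℝ :=
  ((Real.sqrt (2 * Real.pi) * s) ^ d)⁻¹ * Real.exp (-‖x‖ ^ 2 / (2 * s ^ 2))

theorem isoGaussianPDF_pos {d : ℕ} {s : ℝ} (hs : 0 < s) (x : EuclideanSpace ℝ (Fin d)) :
    0 < isoGaussianPDF d s x := by
  unfold isoGaussianPDF; positivity

@[fun_prop]
theorem continuous_isoGaussianPDF (d : ℕ) (s : ℝ) : Continuous (isoGaussianPDF d s) := by
  unfold isoGaussianPDF; fun_prop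

theorem integral_exp_neg_mul_sq_norm_euclidean (d : ℕ) {b : ℝ} (hb : 0 < b) :
    ∫ v : EuclideanSpace ℝ (Fin d), Real.exp (-b * ‖v‖ ^ 2) = Real.sqrt (Real.pi / b) ^ d := by
  rw [GaussianFourier.integral_rexp_neg_mul_sq_norm hb, Real.sqrt_eq_rpow, ← Real.rpow_natCast,
    ← Real.rpow_mul (by positivity)]
  congr 1
  simp; ring

theorem integrable_exp_neg_mul_sq_norm_euclidean (d : ℕ) {b : ℝ} (hb : 0 < b) :
    Integrable fun v : EuclideanSpace ℝ (Fin d) => Real.exp (-b * ‖v‖ ^ 2) := by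
  by_contra h
  -- A non-integrable function has integral zero by convention, but the known value is positive.
  have h1 := integral_undef h
  rw [integral_exp_neg_mul_sq_norm_euclidean d hb] at h1
  have : 0 < Real.sqrt (Real.pi / b) ^ d := by positivity
  exact this.ne' h1

theorem lintegral_exp_neg_mul_sq_norm_euclidean (d : ℕ) {b : ℝ} (hb : 0 < b) :
    ∫⁻ v : EuclideanSpace ℝ (Fin d), ENNReal.ofReal (Real.exp (-b * ‖v‖ ^ 2)) =
      ENNReal.ofReal (Real.sqrt (Real.pi / b) ^ d) := by
  rw [← integral_exp_neg_mul_sq_norm_euclidean d hb, ofReal_integral_eq_lintegral_ofReal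
    (integrable_exp_neg_mul_sq_norm_euclidean d hb) (ae_of_all _ fun _ => (Real.exp_pos _).le)]

theorem isoGaussianPDF_eq (d : ℕ) (s : ℝ) :
    isoGaussianPDF d s = fun x => ((Real.sqrt (2 * Real.pi) * s) ^ d)⁻¹ *
      Real.exp (-(1 / (2 * s ^ 2)) * ‖x‖ ^ 2) := by
  funext x; unfold isoGaussianPDF; congr 2; ring

theorem sqrt_pi_div_inv_two_mul_sq {s : ℝ} (hs : 0 < s) :
    Real.sqrt (Real.pi / (1 / (2 * s ^ 2))) = Real.sqrt (2 * Real.pi) * s := by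
  rw [show Real.pi / (1 / (2 * s ^ 2)) = (2 * Real.pi) * s ^ 2 by field_simp,
    Real.sqrt_mul (by positivity), Real.sqrt_sq hs.le]

theorem integrable_isoGaussianPDF (d : ℕ) {s : ℝ} (hs : 0 < s) :
    Integrable (isoGaussianPDF d s) := by
  rw [isoGaussianPDF_eq]
  exact (integrable_exp_neg_mul_sq_norm_euclidean d (by positivity)).const_mul _

theorem charFun_isoGaussian (d : ℕ) (s : ℝ) (t : EuclideanSpace ℝ (Fin d)) :
    charFun (isoGaussian d s) t = Complex.exp (-((s ^ 2 * ‖t‖ ^ 2 / 2 : ℝ) : ℂ)) := by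
  rw [isoGaussian, charFun_multivariateGaussian (posSemidef_sq_smul_one d s)]
  congr 1
  simp only [inner_zero_right, Complex.ofReal_zero, zero_mul, zero_sub]
  rw [Matrix.smul_mulVec, Matrix.one_mulVec, dotProduct_smul, EuclideanSpace.real_norm_sq_eq]
  simp [dotProduct, pow_two]

-- Both sides are finite measures with the same characteristic function; on the density side it is
-- the Gaussian Fourier integral.
open scoped RealInnerProductSpace in
theorem isoGaussian_eq_withDensity (d : ℕ) {s : ℝ} (hs : 0 < s) :
    isoGaussian d s =
      (volume : Measure (EuclideanSpace ℝ (Fin d))).withDensity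
        (fun x => ENNReal.ofReal (isoGaussianPDF d s x)) := by
  have : IsFiniteMeasure ((volume : Measure (EuclideanSpace ℝ (Fin d))).withDensity
        (fun x => ENNReal.ofReal (isoGaussianPDF d s x))) :=
    isFiniteMeasure_withDensity_ofReal (integrable_isoGaussianPDF d hs).2
  apply Measure.ext_of_charFun
  ext t
  rw [charFun_isoGaussian, charFun_apply,
    integral_withDensity_eq_integral_toReal_smul (by fun_prop) (ae_of_all _ fun _ => by simp)]
  have h := GaussianFourier.integral_cexp_neg_mul_sq_norm_add (V := EuclideanSpace ℝ (Fin d))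
    (b := ((1 / (2 * s ^ 2) : ℝ) : ℂ)) (by rw [Complex.ofReal_re]; positivity) Complex.I t
  have h2 : ∀ x : EuclideanSpace ℝ (Fin d),
      (ENNReal.ofReal (isoGaussianPDF d s x)).toReal • Complex.exp (⟪x, t⟫ * Complex.I) =
      ((((Real.sqrt (2 * Real.pi) * s) ^ d)⁻¹ : ℝ) : ℂ) *
        Complex.exp (-((1 / (2 * s ^ 2) : ℝ) : ℂ) * ‖x‖ ^ 2 + Complex.I * ⟪t, x⟫) := by
    intro x
    rw [ENNReal.toReal_ofReal (isoGaussianPDF_pos hs x).le, isoGaussianPDF_eq, Complex.exp_add,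
      Complex.real_smul, real_inner_comm]
    push_cast
    rw [mul_comm Complex.I]
    ring
  simp_rw [h2]
  rw [integral_const_mul, h]
  have h3 : ((Real.pi : ℂ) / ((1 / (2 * s ^ 2) : ℝ) : ℂ)) ^
      (Module.finrank ℝ (EuclideanSpace ℝ (Fin d)) / 2 : ℂ) =
      (((Real.sqrt (2 * Real.pi) * s) ^ d : ℝ) : ℂ) := by
    have h4 : (Real.sqrt (2 * Real.pi) * s) ^ d =
        (Real.pi / (1 / (2 * s ^ 2))) ^ ((d : ℝ) / 2) := by
      rw [← sqrt_pi_div_inv_two_mul_sq hs, Real.sqrt_eq_rpow, ← Real.rpow_natCast,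
        ← Real.rpow_mul (by positivity)]
      congr 1; ring
    rw [h4, Complex.ofReal_cpow (by positivity)]
    simp
  rw [h3, ← mul_assoc, ← Complex.ofReal_mul, inv_mul_cancel₀ (by positivity), Complex.ofReal_one,
    one_mul]
  congr 1
  have : (s : ℂ) ≠ 0 := by exact_mod_cast hs.ne'
  rw [Complex.I_sq]
  push_cast
  field_simp
  ring

/-- A product of measures with densities has the product density. -/
theorem MeasureTheory.Measure.pi_withDensity_ofReal {ι α : Type*} [Fintype ι] [MeasurableSpace α]
    {μ : Measure α} [SigmaFinite μ] {f : α → ℝ} (hf : Integrable f μ) (h0 : ∀ x, 0 ≤ f x) :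
    (Measure.pi fun _ : ι => μ.withDensity fun x => ENNReal.ofReal (f x)) =
      (Measure.pi fun _ : ι => μ).withDensity fun x => ENNReal.ofReal (∏ i, f (x i)) := by
  have : IsFiniteMeasure (μ.withDensity fun x => ENNReal.ofReal (f x)) :=
    isFiniteMeasure_withDensity_ofReal hf.2
  refine Measure.pi_eq fun s hs => ?_
  rw [withDensity_apply _ (MeasurableSet.univ_pi hs), Measure.restrict_pi_pi,
    ← ofReal_integral_eq_lintegral_ofReal
      (Integrable.fintype_prod (μ := fun i => μ.restrict (s i)) fun i => hf.integrableOn)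
      (ae_of_all _ fun x => Finset.prod_nonneg fun i _ => h0 _),
    integral_fintype_prod_eq_prod (fun _ => f),
    ENNReal.ofReal_prod_of_nonneg fun i _ => integral_nonneg h0]
  refine Finset.prod_congr rfl fun i _ => ?_
  rw [withDensity_apply _ (hs i), ofReal_integral_eq_lintegral_ofReal hf.integrableOn
    (ae_of_all _ h0)]

/-! ### Lower bounds for Gaussian ball probabilities. -/

theorem sqrt_two_pi_mul_exp_two_le : Real.sqrt (2 * Real.pi) * Real.exp 2 ≤ 20 := by
  have h1 : Real.sqrt (2 * Real.pi) ≤ 2.51 := by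
    rw [Real.sqrt_le_left (by norm_num)]
    have := Real.pi_lt_d2
    norm_num; linarith
  have h2 : Real.exp 2 ≤ 7.4 := by
    have := Real.exp_one_lt_d9
    rw [show (2 : ℝ) = 1 + 1 by norm_num, Real.exp_add]
    have h3 := Real.exp_pos 1
    nlinarith
  calc _ ≤ (2.51 : ℝ) * 7.4 := by gcongr
    _ ≤ 20 := by norm_num

/-- The ball contains the cube of side `2 r` centred at `x`. This replaces the exact volume formula,
as only a bound of the form `c^d` is needed. -/
theorem EuclideanSpace.volume_closedBall_mul_sqrt_ge {d : ℕ} (x : EuclideanSpace ℝ (Fin d)) {r : ℝ}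
    (hr : 0 ≤ r) :
    ENNReal.ofReal ((2 * r) ^ d) ≤ volume (Metric.closedBall x (r * Real.sqrt d)) := by
  have h1 : volume (WithLp.ofLp (p := 2) ⁻¹' (Set.Icc (fun i : Fin d => x i - r) fun i => x i + r)) =
      ENNReal.ofReal ((2 * r) ^ d) := by
    rw [(PiLp.volume_preserving_ofLp (Fin d)).measure_preimage measurableSet_Icc.nullMeasurableSet,
      Real.volume_Icc_pi, ← ENNReal.ofReal_prod_of_nonneg]
    · congr 1
      rw [Finset.prod_congr rfl fun i _ => show x i + r - (x i - r) = 2 * r by ring]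
      simp
    · intro i _; linarith
  rw [← h1]
  refine measure_mono fun y hy => ?_
  rw [Metric.mem_closedBall, EuclideanSpace.dist_eq, Real.sqrt_le_left (by positivity), mul_pow,
    Real.sq_sqrt (by positivity)]
  calc ∑ i, dist (y i) (x i) ^ 2 ≤ ∑ i : Fin d, r ^ 2 := by
        refine Finset.sum_le_sum fun i _ => ?_
        rw [Real.dist_eq]
        refine pow_le_pow_left₀ (abs_nonneg _) ?_ 2
        have h2 := hy.1 i
        have h3 := hy.2 i
        rw [abs_le]
        constructor <;> linarith
    _ = r ^ 2 * d := by simp [mul_comm]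

/-- Points of the ball have norm at most `2 s √d`, so the density there loses at most `exp (-2 d)`
against its maximum; multiply by the volume of the inscribed cube. -/
theorem isoGaussian_closedBall_ge {d : ℕ} {s τ : ℝ} (hs : 0 < s) (h0 : 0 ≤ τ) (h1 : τ ≤ 1)
    {x : EuclideanSpace ℝ (Fin d)} (hx : ‖x‖ ≤ s * Real.sqrt d) :
    ENNReal.ofReal ((τ / 10) ^ d) ≤
      isoGaussian d s (Metric.closedBall x (τ * s * Real.sqrt d)) := by
  rw [isoGaussian_eq_withDensity d hs, withDensity_apply _ measurableSet_closedBall]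
  have hpdf : ∀ y ∈ Metric.closedBall x (τ * s * Real.sqrt d),
      ENNReal.ofReal (((Real.sqrt (2 * Real.pi) * s) ^ d)⁻¹ * Real.exp (-2) ^ d) ≤
        ENNReal.ofReal (isoGaussianPDF d s y) := by
    intro y hy
    refine ENNReal.ofReal_le_ofReal ?_
    unfold isoGaussianPDF
    refine mul_le_mul_of_nonneg_left ?_ (by positivity)
    rw [← Real.exp_nat_mul, Real.exp_le_exp, le_div_iff₀ (by positivity)]
    have hy2 : ‖y‖ ≤ 2 * (s * Real.sqrt d) := by
      have h2 : ‖y‖ ≤ ‖x‖ + dist y x := by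
        rw [dist_eq_norm]
        calc ‖y‖ = ‖x + (y - x)‖ := by rw [add_sub_cancel]
          _ ≤ _ := norm_add_le _ _
      have h3 : τ * s * Real.sqrt d ≤ s * Real.sqrt d := by
        have : 0 ≤ s * Real.sqrt d := by positivity
        nlinarith
      have := Metric.mem_closedBall.1 hy
      linarith
    have hy3 : ‖y‖ ^ 2 ≤ (2 * (s * Real.sqrt d)) ^ 2 := pow_le_pow_left₀ (norm_nonneg _) hy2 2
    rw [mul_pow, mul_pow, Real.sq_sqrt (by positivity)] at hy3
    linarith
  calc ENNReal.ofReal ((τ / 10) ^ d)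
      ≤ ENNReal.ofReal (((Real.sqrt (2 * Real.pi) * s) ^ d)⁻¹ * Real.exp (-2) ^ d) *
        ENNReal.ofReal ((2 * (τ * s)) ^ d) := by
        rw [← ENNReal.ofReal_mul (by positivity)]
        refine ENNReal.ofReal_le_ofReal ?_
        rw [← inv_pow, ← mul_pow, ← mul_pow]
        refine pow_le_pow_left₀ (by positivity) ?_ d
        rw [show (Real.sqrt (2 * Real.pi) * s)⁻¹ * Real.exp (-2) * (2 * (τ * s)) =
          2 * τ / (Real.sqrt (2 * Real.pi) * Real.exp 2) by
            rw [Real.exp_neg]; field_simp]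
        rw [div_le_div_iff₀ (by norm_num) (by positivity)]
        nlinarith [sqrt_two_pi_mul_exp_two_le]
    _ ≤ ENNReal.ofReal (((Real.sqrt (2 * Real.pi) * s) ^ d)⁻¹ * Real.exp (-2) ^ d) *
        volume (Metric.closedBall x (τ * s * Real.sqrt d)) := by
        gcongr
        exact EuclideanSpace.volume_closedBall_mul_sqrt_ge x (by positivity)
    _ ≤ _ := by
        rw [← setLIntegral_const]
        exact setLIntegral_mono' measurableSet_closedBall hpdf

/-! ### Chernoff estimates for the nearest-neighbour rule. -/

-- Complete the square: `‖z‖² + ‖v + z‖² = 2 ‖z + v/2‖² + ‖v‖²/2`, so the integrand times the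
-- density is a translated Gaussian density times a constant.
open scoped RealInnerProductSpace in
theorem lintegral_exp_sq_norm_sub_isoGaussian {d : ℕ} {s : ℝ} (hs : 0 < s)
    (v : EuclideanSpace ℝ (Fin d)) :
    ∫⁻ z, ENNReal.ofReal (Real.exp ((‖z‖ ^ 2 - ‖v + z‖ ^ 2) / (4 * s ^ 2))) ∂isoGaussian d s =
      ENNReal.ofReal (Real.exp (-‖v‖ ^ 2 / (8 * s ^ 2))) := by
  have hnorm : ∫⁻ z, ENNReal.ofReal (isoGaussianPDF d s z) = 1 := by
    have := measure_univ (μ := isoGaussian d s)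
    rwa [isoGaussian_eq_withDensity d hs, withDensity_apply _ MeasurableSet.univ,
      Measure.restrict_univ] at this
  rw [isoGaussian_eq_withDensity d hs, lintegral_withDensity_eq_lintegral_mul _ (by fun_prop)
    (by fun_prop)]
  have h : ∀ z : EuclideanSpace ℝ (Fin d),
      ((fun x => ENNReal.ofReal (isoGaussianPDF d s x)) *
        fun z => ENNReal.ofReal (Real.exp ((‖z‖ ^ 2 - ‖v + z‖ ^ 2) / (4 * s ^ 2)))) z =
      ENNReal.ofReal (Real.exp (-‖v‖ ^ 2 / (8 * s ^ 2))) *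
        ENNReal.ofReal (isoGaussianPDF d s (z + (1 / 2 : ℝ) • v)) := by
    intro z
    rw [Pi.mul_apply, ← ENNReal.ofReal_mul (isoGaussianPDF_pos hs z).le,
      ← ENNReal.ofReal_mul (Real.exp_pos _).le]
    congr 1
    unfold isoGaussianPDF
    rw [mul_left_comm, mul_assoc, ← Real.exp_add, ← Real.exp_add, norm_add_sq_real,
      norm_add_sq_real, norm_smul, inner_smul_right, real_inner_comm z v]
    congr 2
    rw [Real.norm_of_nonneg (by norm_num)]
    field_simp
    ring
  rw [lintegral_congr h, lintegral_const_mul _ (by fun_prop),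
    lintegral_add_right_eq_self (fun z => ENNReal.ofReal (isoGaussianPDF d s z)), hnorm, mul_one]

theorem isoGaussian_norm_add_le_norm {d : ℕ} {s : ℝ} (hs : 0 < s)
    (v : EuclideanSpace ℝ (Fin d)) :
    isoGaussian d s {z | ‖v + z‖ ≤ ‖z‖} ≤ ENNReal.ofReal (Real.exp (-‖v‖ ^ 2 / (8 * s ^ 2))) := by
  have hm : MeasurableSet {z : EuclideanSpace ℝ (Fin d) | ‖v + z‖ ≤ ‖z‖} :=
    measurableSet_le (by fun_prop) (by fun_prop)
  rw [← lintegral_exp_sq_norm_sub_isoGaussian hs, ← lintegral_indicator_one hm]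
  refine lintegral_mono fun z => ?_
  by_cases hz : z ∈ {z : EuclideanSpace ℝ (Fin d) | ‖v + z‖ ≤ ‖z‖}
  · rw [Set.indicator_of_mem hz, Pi.one_apply, ENNReal.one_le_ofReal, Real.one_le_exp_iff]
    have := pow_le_pow_left₀ (norm_nonneg _) (show ‖v + z‖ ≤ ‖z‖ from hz) 2
    exact div_nonneg (by linarith) (by positivity)
  · rw [Set.indicator_of_notMem hz]; exact zero_le

/-- Bound the standard density by its maximum and integrate the remaining Gaussian over the whole
space; translation invariance makes the bound uniform in `a`. -/
theorem lintegral_exp_neg_sq_norm_sub_isoGaussian_one_le {d : ℕ} {s : ℝ} (hs : 0 < s)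
    (a : EuclideanSpace ℝ (Fin d)) :
    ∫⁻ x, ENNReal.ofReal (Real.exp (-‖a - x‖ ^ 2 / (8 * s ^ 2))) ∂isoGaussian d 1 ≤
      ENNReal.ofReal ((2 * s) ^ d) := by
  rw [isoGaussian_eq_withDensity d one_pos, lintegral_withDensity_eq_lintegral_mul _ (by fun_prop)
    (by fun_prop)]
  calc _ ≤ ∫⁻ x, ENNReal.ofReal ((Real.sqrt (2 * Real.pi) ^ d)⁻¹) *
        ENNReal.ofReal (Real.exp (-(1 / (8 * s ^ 2)) * ‖x - a‖ ^ 2)) := by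
        refine lintegral_mono fun x => ?_
        rw [Pi.mul_apply]
        refine mul_le_mul' (ENNReal.ofReal_le_ofReal ?_) (ENNReal.ofReal_le_ofReal ?_)
        · unfold isoGaussianPDF
          rw [mul_one]
          refine mul_le_of_le_one_right (by positivity) (Real.exp_le_one_iff.2 ?_)
          exact div_nonpos_of_nonpos_of_nonneg (by simp) (by norm_num)
        · rw [norm_sub_rev]
          apply le_of_eq
          congr 1
          ring
    _ = ENNReal.ofReal ((2 * s) ^ d) := by
        rw [lintegral_const_mul _ (by fun_prop), lintegral_sub_right_eq_self
          (fun x : EuclideanSpace ℝ (Fin d) =>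
            ENNReal.ofReal (Real.exp (-(1 / (8 * s ^ 2)) * ‖x‖ ^ 2))),
          lintegral_exp_neg_mul_sq_norm_euclidean d (by positivity),
          ← ENNReal.ofReal_mul (by positivity), ← inv_pow, ← mul_pow]
        congr 2
        rw [show Real.pi / (1 / (8 * s ^ 2)) = (2 * Real.pi) * (2 * s) ^ 2 by field_simp; ring,
          Real.sqrt_mul (x := 2 * Real.pi) (by positivity), Real.sqrt_sq (by positivity),
          inv_mul_cancel_left₀]
        positivity

/-! ### The risk as an average of per-index error probabilities. -/

instance permDiscreteMeasurableSpace (n : ℕ) : DiscreteMeasurableSpace (Equiv.Perm (Fin n)) :=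
  ⟨fun _ => trivial⟩

theorem measurable_observed {n d : ℕ} (π : Equiv.Perm (Fin n)) :
    Measurable fun p : PointConfig n d × PointConfig n d => observed π p.1 p.2 := by
  unfold observed; fun_prop

theorem measurable_estimator_observed {n d : ℕ} (est : Estimator n d) (π : Equiv.Perm (Fin n)) :
    Measurable fun p : PointConfig n d × PointConfig n d =>
      est.toFun p.1 (observed π p.1 p.2) :=
  est.measurable_toFun.comp (measurable_fst.prodMk (measurable_observed π))

/-- The event that the estimator misplaces `i` when the planted permutation is `π`. -/
def errorEvent {n d : ℕ} (est : Estimator n d) (π : Equiv.Perm (Fin n)) (i : Fin n) :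
    Set (PointConfig n d × PointConfig n d) :=
  {p | est.toFun p.1 (observed π p.1 p.2) i ≠ π i}

theorem measurableSet_errorEvent {n d : ℕ} (est : Estimator n d) (π : Equiv.Perm (Fin n))
    (i : Fin n) : MeasurableSet (errorEvent est π i) :=
  measurable_estimator_observed est π
    (MeasurableSet.of_discrete (s := {ρ : Equiv.Perm (Fin n) | ρ i ≠ π i}))

theorem measurable_hammingDist_estimator {n d : ℕ} (est : Estimator n d) :
    Measurable fun ω : Equiv.Perm (Fin n) × PointConfig n d × PointConfig n d =>
      (hammingDist (⇑(est.toFun ω.2.1 (observed ω.1 ω.2.1 ω.2.2))) (⇑ω.1) : ℝ) := by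
  refine measurable_from_prod_countable_right fun π => ?_
  exact (measurable_of_countable fun ρ : Equiv.Perm (Fin n) => (hammingDist ⇑ρ ⇑π : ℝ)).comp
    (measurable_estimator_observed est π)

theorem ofReal_risk {n d : ℕ} (P Q : Measure (EuclideanSpace ℝ (Fin d))) [IsProbabilityMeasure P]
    [IsProbabilityMeasure Q] (est : Estimator n d) :
    ENNReal.ofReal (risk P Q est) =
      ∑ π : Equiv.Perm (Fin n), (∑ i, ((Measure.pi fun _ : Fin n => P).prod
        (Measure.pi fun _ : Fin n => Q)) (errorEvent est π i)) *
        (Fintype.card (Equiv.Perm (Fin n)) : ENNReal)⁻¹ := by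
  have hm := measurable_hammingDist_estimator est
  have : IsProbabilityMeasure (plantedLaw n P Q) := by unfold plantedLaw; infer_instance
  have hint : Integrable (fun ω : Equiv.Perm (Fin n) × PointConfig n d × PointConfig n d =>
      (hammingDist (⇑(est.toFun ω.2.1 (observed ω.1 ω.2.1 ω.2.2))) (⇑ω.1) : ℝ))
      (plantedLaw n P Q) := by
    refine Integrable.of_bound hm.aestronglyMeasurable n (ae_of_all _ fun ω => ?_)
    rw [Real.norm_of_nonneg (by positivity)]
    exact_mod_cast hammingDist_le_card_fintype.trans (by simp)
  rw [risk, ofReal_integral_eq_lintegral_ofReal hint (ae_of_all _ fun _ => by positivity),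
    plantedLaw, lintegral_prod _ hm.ennreal_ofReal.aemeasurable, lintegral_fintype]
  refine Finset.sum_congr rfl fun π _ => ?_
  rw [PMF.toMeasure_apply_singleton _ _ (MeasurableSet.of_discrete), PMF.uniformOfFintype_apply]
  congr 1
  have h : ∀ p : PointConfig n d × PointConfig n d,
      ENNReal.ofReal (hammingDist (⇑(est.toFun p.1 (observed π p.1 p.2))) (⇑π) : ℝ) =
        ∑ i, (errorEvent est π i).indicator 1 p := by
    intro p
    rw [ENNReal.ofReal_natCast, hammingDist, Finset.card_eq_sum_ones, Finset.sum_filter,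
      Nat.cast_sum]
    refine Finset.sum_congr rfl fun i _ => ?_
    simp only [Set.indicator_apply, errorEvent, Set.mem_ofPred_eq, Pi.one_apply]
    split_ifs <;> simp
  simp_rw [h]
  rw [lintegral_finsetSum _ fun i _ => measurable_one.indicator (measurableSet_errorEvent est π i)]
  exact Finset.sum_congr rfl fun i _ => lintegral_indicator_one (measurableSet_errorEvent est π i)

theorem risk_nonneg {n d : ℕ} (P Q : Measure (EuclideanSpace ℝ (Fin d))) (est : Estimator n d) :
    0 ≤ risk P Q est := integral_nonneg fun _ => by positivity

theorem minRisk_le_risk {n d : ℕ} (P Q : Measure (EuclideanSpace ℝ (Fin d)))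
    (est : Estimator n d) : minRisk n P Q ≤ risk P Q est :=
  ciInf_le ⟨0, by rintro _ ⟨e, rfl⟩; exact risk_nonneg P Q e⟩ est

theorem minRisk_le_card {n d : ℕ} (P Q : Measure (EuclideanSpace ℝ (Fin d)))
    [IsProbabilityMeasure P] [IsProbabilityMeasure Q] : minRisk n P Q ≤ n := by
  refine (minRisk_le_risk P Q (Classical.arbitrary _)).trans ?_
  rw [← ENNReal.ofReal_le_ofReal_iff (by positivity), ofReal_risk]
  calc _ ≤ ∑ π : Equiv.Perm (Fin n), (∑ i : Fin n, 1) *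
        (Fintype.card (Equiv.Perm (Fin n)) : ENNReal)⁻¹ := by
        gcongr; exact prob_le_one
    _ = ENNReal.ofReal n := by
        rw [Finset.sum_const, Finset.card_univ, nsmul_eq_mul, mul_left_comm,
          ENNReal.mul_inv_cancel (by simp [Fintype.card_ne_zero]) (by simp), mul_one]
        simp

/-! ### The nearest-neighbour upper bound. -/

/-- The joint law of two distinct coordinates of an i.i.d. sequence. -/
theorem MeasureTheory.Measure.map_eval_pair_pi {ι α : Type*} [Fintype ι] [MeasurableSpace α]
    (P : Measure α) [IsProbabilityMeasure P] {k l : ι} (hkl : k ≠ l) :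
    (Measure.pi fun _ : ι => P).map (fun X => (X k, X l)) = P.prod P := by
  have h := (iIndepFun_pi (μ := fun _ : ι => P) (X := fun _ => id)
    fun _ => aemeasurable_id).indepFun hkl
  simp only [id_eq] at h
  rw [indepFun_iff_map_prod_eq_prod_map_map (f := fun X : ι → α => X k) (g := fun X : ι → α => X l)
    (measurable_pi_apply k).aemeasurable (measurable_pi_apply l).aemeasurable] at h
  rw [h]
  exact congrArg₂ Measure.prod (measurePreserving_eval (fun _ : ι => P) k).map_eq
    (measurePreserving_eval (fun _ : ι => P) l).map_eq

/-- With `X` fixed this is the Chernoff bound in the noise; then average over the independent points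
`X l` and `X k`. -/
theorem prob_norm_sub_add_le_norm {n d : ℕ} {s : ℝ} (hs : 0 < s) {k l i : Fin n} (hkl : k ≠ l) :
    ((Measure.pi fun _ : Fin n => isoGaussian d 1).prod
      (Measure.pi fun _ : Fin n => isoGaussian d s))
      {p | ‖p.1 l - p.1 k + p.2 i‖ ≤ ‖p.2 i‖} ≤ ENNReal.ofReal ((2 * s) ^ d) := by
  have hm : MeasurableSet {p : PointConfig n d × PointConfig n d |
      ‖p.1 l - p.1 k + p.2 i‖ ≤ ‖p.2 i‖} := measurableSet_le (by fun_prop) (by fun_prop)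
  rw [Measure.prod_apply hm]
  calc _ ≤ ∫⁻ X : PointConfig n d, ENNReal.ofReal (Real.exp (-‖X l - X k‖ ^ 2 / (8 * s ^ 2)))
        ∂Measure.pi fun _ => isoGaussian d 1 := by
        refine lintegral_mono fun X => ?_
        have hm2 : MeasurableSet {z : EuclideanSpace ℝ (Fin d) | ‖X l - X k + z‖ ≤ ‖z‖} :=
          measurableSet_le (by fun_prop) (by fun_prop)
        refine le_trans (le_of_eq ?_) (isoGaussian_norm_add_le_norm hs (X l - X k))
        exact (measurePreserving_eval (fun _ : Fin n => isoGaussian d s) i).measure_preimage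
          hm2.nullMeasurableSet
    _ = ∫⁻ q : EuclideanSpace ℝ (Fin d) × EuclideanSpace ℝ (Fin d),
          ENNReal.ofReal (Real.exp (-‖q.1 - q.2‖ ^ 2 / (8 * s ^ 2)))
          ∂(isoGaussian d 1).prod (isoGaussian d 1) := by
        rw [← Measure.map_eval_pair_pi (isoGaussian d 1) hkl.symm,
          lintegral_map (by fun_prop) (by fun_prop)]
    _ = ∫⁻ a, ∫⁻ x, ENNReal.ofReal (Real.exp (-‖a - x‖ ^ 2 / (8 * s ^ 2))) ∂isoGaussian d 1
          ∂isoGaussian d 1 := lintegral_prod _ (by fun_prop)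
    _ ≤ ∫⁻ _, ENNReal.ofReal ((2 * s) ^ d) ∂isoGaussian d 1 :=
        lintegral_mono fun a => lintegral_exp_neg_sq_norm_sub_isoGaussian_one_le hs a
    _ = _ := by simp

open scoped Classical in
/-- The number of `i` that a permutation matches in accordance with the relation `B`. -/
noncomputable def matchScore {n : ℕ} (B : Fin n → Fin n → Prop) (π : Equiv.Perm (Fin n)) : ℕ :=
  (Finset.univ.filter fun i => B i (π i)).card

/-- A permutation with the most matches in accordance with the relation `B`. -/
noncomputable def bestMatch {n : ℕ} (B : Fin n → Fin n → Prop) : Equiv.Perm (Fin n) :=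
  (Finite.exists_max (matchScore B)).choose

theorem matchScore_le_bestMatch {n : ℕ} (B : Fin n → Fin n → Prop) (π : Equiv.Perm (Fin n)) :
    matchScore B π ≤ matchScore B (bestMatch B) :=
  (Finite.exists_max (matchScore B)).choose_spec π

-- Where both permutations respect `B` they agree, by `hB`. By maximality `bestMatch B` violates `B`
-- no more often than `π`, whence the factor 2.
open scoped Classical in
theorem hammingDist_bestMatch_le {n : ℕ} {B : Fin n → Fin n → Prop}
    (hB : ∀ i k l, B i k → B i l → k = l) (π : Equiv.Perm (Fin n)) :
    hammingDist ⇑(bestMatch B) ⇑π ≤ 2 * (Finset.univ.filter fun i => ¬ B i (π i)).card := by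
  have h1 : (Finset.univ.filter fun i => bestMatch B i ≠ π i) ⊆
      (Finset.univ.filter fun i => ¬ B i (bestMatch B i)) ∪
        Finset.univ.filter fun i => ¬ B i (π i) := by
    intro i hi
    simp only [Finset.mem_union, Finset.mem_filter, Finset.mem_univ, true_and] at hi ⊢
    by_contra! h
    exact hi (hB i _ _ h.1 h.2)
  have h2 := (Finset.card_le_card h1).trans (Finset.card_union_le _ _)
  have h3 := matchScore_le_bestMatch B π
  have h4 := Finset.card_filter_add_card_filter_not (s := Finset.univ) fun i => B i (π i)
  have h5 := Finset.card_filter_add_card_filter_not (s := Finset.univ)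
    fun i => B i (bestMatch B i)
  unfold matchScore at h3
  have h6 : hammingDist ⇑(bestMatch B) ⇑π =
    (Finset.univ.filter fun i => bestMatch B i ≠ π i).card := by
    unfold hammingDist; congr
  omega

/-- `k` is the index of the unique point of `X` nearest to `Y i`. -/
def IsNearest {n d : ℕ} (X Y : PointConfig n d) (i k : Fin n) : Prop :=
  ∀ l, l ≠ k → ‖Y i - X k‖ < ‖Y i - X l‖

theorem IsNearest.unique {n d : ℕ} {X Y : PointConfig n d} {i k l : Fin n}
    (hk : IsNearest X Y i k) (hl : IsNearest X Y i l) : k = l := by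
  by_contra h
  exact lt_asymm (hk l (Ne.symm h)) (hl k h)

/-- The estimator that agrees with the nearest-neighbour assignment as often as possible. -/
noncomputable def nearestNeighbourEstimator (n d : ℕ) : Estimator n d where
  toFun X Y := bestMatch (IsNearest X Y)
  measurable_toFun := by
    -- There are finitely many relations on `Fin n`, so the choice made in `bestMatch` is harmless
    -- and only the comparisons of distances need to be measurable.
    refine (measurable_of_countable (bestMatch (n := n))).comp
      (measurable_pi_lambda _ fun i => measurable_pi_lambda _ fun k => ?_)
    rw [← measurableSet_setOfPred]
    unfold IsNearest
    simp only [Set.ofPred_forall]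
    refine MeasurableSet.iInter fun l => MeasurableSet.iInter fun _ => ?_
    exact measurableSet_lt (by fun_prop) (by fun_prop)

theorem hammingDist_nearestNeighbourEstimator_le {n d : ℕ} (π : Equiv.Perm (Fin n))
    (X Z : PointConfig n d) :
    ((hammingDist ⇑((nearestNeighbourEstimator n d).toFun X (observed π X Z)) ⇑π : ℕ) : ENNReal) ≤
      2 * ∑ i, ∑ k ∈ Finset.univ.filter (· ≠ π i),
        Set.indicator {p : PointConfig n d × PointConfig n d |
          ‖p.1 (π i) - p.1 k + p.2 i‖ ≤ ‖p.2 i‖} 1 (X, Z) := by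
  classical
  have hB : ∀ i k l, IsNearest X (observed π X Z) i k → IsNearest X (observed π X Z) i l →
      k = l := fun i k l => IsNearest.unique
  have h := hammingDist_bestMatch_le hB π
  have hest : (nearestNeighbourEstimator n d).toFun X (observed π X Z) =
      bestMatch (IsNearest X (observed π X Z)) := rfl
  rw [hest]
  refine (Nat.cast_le.2 h).trans ?_
  rw [Nat.cast_mul, Nat.cast_ofNat]
  gcongr
  rw [Finset.card_eq_sum_ones, Finset.sum_filter, Nat.cast_sum]
  refine Finset.sum_le_sum fun i _ => ?_
  by_cases h : IsNearest X (observed π X Z) i (π i)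
  · simp [h]
  · rw [if_pos h]
    simp only [IsNearest, observed, not_forall, not_lt] at h
    obtain ⟨k, hk, hle⟩ := h
    have hmem : (X, Z) ∈ {p : PointConfig n d × PointConfig n d |
        ‖p.1 (π i) - p.1 k + p.2 i‖ ≤ ‖p.2 i‖} := by
      simp only [Set.mem_ofPred_eq]
      rwa [add_sub_cancel_left, add_sub_right_comm] at hle
    refine le_trans ?_ (Finset.single_le_sum (fun _ _ => zero_le)
      (Finset.mem_filter.2 ⟨Finset.mem_univ k, hk⟩))
    rw [Set.indicator_of_mem hmem]; simp

theorem minRisk_isoGaussian_le {n d : ℕ} {s : ℝ} (hs : 0 < s) :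
    minRisk n (isoGaussian d 1) (isoGaussian d s) ≤ 2 * n ^ 2 * (2 * s) ^ d := by
  refine (minRisk_le_risk _ _ (nearestNeighbourEstimator n d)).trans ?_
  rw [← ENNReal.ofReal_le_ofReal_iff (by positivity), ofReal_risk]
  set μ := (Measure.pi fun _ : Fin n => isoGaussian d 1).prod
    (Measure.pi fun _ : Fin n => isoGaussian d s)
  set est := nearestNeighbourEstimator n d
  have key : ∀ π : Equiv.Perm (Fin n), ∑ i, μ (errorEvent est π i) ≤
      ENNReal.ofReal (2 * n ^ 2 * (2 * s) ^ d) := by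
    intro π
    have hm : ∀ i k : Fin n, MeasurableSet {p : PointConfig n d × PointConfig n d |
        ‖p.1 (π i) - p.1 k + p.2 i‖ ≤ ‖p.2 i‖} :=
      fun i k => measurableSet_le (by fun_prop) (by fun_prop)
    calc ∑ i, μ (errorEvent est π i)
        = ∫⁻ p, ∑ i, (errorEvent est π i).indicator 1 p ∂μ := by
          rw [lintegral_finsetSum _ fun i _ =>
            measurable_one.indicator (measurableSet_errorEvent est π i)]
          exact Finset.sum_congr rfl fun i _ =>
            (lintegral_indicator_one (measurableSet_errorEvent est π i)).symm
      _ ≤ ∫⁻ p, 2 * ∑ i, ∑ k ∈ Finset.univ.filter (· ≠ π i),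
          Set.indicator {p : PointConfig n d × PointConfig n d |
            ‖p.1 (π i) - p.1 k + p.2 i‖ ≤ ‖p.2 i‖} 1 p ∂μ := by
          refine lintegral_mono fun p => le_trans (le_of_eq ?_)
            (hammingDist_nearestNeighbourEstimator_le π p.1 p.2)
          rw [hammingDist, Finset.card_eq_sum_ones, Finset.sum_filter, Nat.cast_sum]
          refine Finset.sum_congr rfl fun i _ => ?_
          simp only [Set.indicator_apply, errorEvent, Set.mem_ofPred_eq, Pi.one_apply]
          split_ifs <;> first | contradiction | simp
      _ = 2 * ∑ i, ∑ k ∈ Finset.univ.filter (· ≠ π i),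
          μ {p : PointConfig n d × PointConfig n d |
            ‖p.1 (π i) - p.1 k + p.2 i‖ ≤ ‖p.2 i‖} := by
          rw [lintegral_const_mul _ (Finset.measurable_sum _ fun i _ =>
              Finset.measurable_sum _ fun k _ => measurable_one.indicator (hm i k)),
            lintegral_finsetSum _ fun i _ =>
              Finset.measurable_sum _ fun k _ => measurable_one.indicator (hm i k)]
          congr 1
          refine Finset.sum_congr rfl fun i _ => ?_
          rw [lintegral_finsetSum _ fun k _ => measurable_one.indicator (hm i k)]
          exact Finset.sum_congr rfl fun k _ => lintegral_indicator_one (hm i k)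
      _ ≤ 2 * ∑ i : Fin n, ∑ k : Fin n, ENNReal.ofReal ((2 * s) ^ d) := by
          gcongr with i _
          refine (Finset.sum_le_sum fun k hk => prob_norm_sub_add_le_norm hs
            (Finset.mem_filter.1 hk).2).trans ?_
          exact Finset.sum_le_sum_of_subset (Finset.filter_subset _ _)
      _ = ENNReal.ofReal (2 * n ^ 2 * (2 * s) ^ d) := by
          rw [ENNReal.ofReal_mul (by positivity), ENNReal.ofReal_mul (by positivity)]
          simp [pow_two, ENNReal.ofReal_mul, mul_assoc]
  calc _ ≤ ∑ π : Equiv.Perm (Fin n), ENNReal.ofReal (2 * n ^ 2 * (2 * s) ^ d) *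
        (Fintype.card (Equiv.Perm (Fin n)) : ENNReal)⁻¹ := by
        gcongr with π _; exact key π
    _ = _ := by
        rw [Finset.sum_const, Finset.card_univ, nsmul_eq_mul, mul_left_comm,
          ENNReal.mul_inv_cancel (by simp [Fintype.card_ne_zero]) (by simp), mul_one]

/-! ### Tools for the lower bound: related terms and exchanges. -/

/-- In an i.i.d. sequence, the probability that the `i`-th term lies in `D` and some other term is
`A`-related to it. -/
theorem MeasureTheory.Measure.pi_exists_rel_ge {α : Type*} [MeasurableSpace α] (M : Measure α)
    [IsProbabilityMeasure M] {m : ℕ} (i : Fin (m + 1)) {D : Set α} (hD : MeasurableSet D)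
    {A : Set (α × α)} (hA : MeasurableSet A) {p : ENNReal}
    (hp : ∀ a ∈ D, p ≤ M {b | (a, b) ∈ A}) :
    M D * (1 - (1 - p) ^ m) ≤
      (Measure.pi fun _ : Fin (m + 1) => M) {ω | ω i ∈ D ∧ ∃ j, j ≠ i ∧ (ω i, ω j) ∈ A} := by
  have hsec : ∀ a : α, MeasurableSet {b | (a, b) ∈ A} := fun a => measurable_prodMk_left hA
  have hset : MeasurableSet {q : α × (Fin m → α) | q.1 ∈ D ∧ ∃ j, (q.1, q.2 j) ∈ A} := by
    have h : MeasurableSet (⋃ j, {q : α × (Fin m → α) | (q.1, q.2 j) ∈ A}) :=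
      MeasurableSet.iUnion fun j =>
        (measurable_fst.prodMk ((measurable_pi_apply j).comp measurable_snd)) hA
    rw [← Set.ofPred_exists] at h
    exact (measurable_fst hD).inter h
  -- Split off coordinate `i`. Once its value is fixed in `D`, the other `m` terms independently
  -- miss the section of `A`, each with probability at most `1 - p`.
  have hpre : {ω : Fin (m + 1) → α | ω i ∈ D ∧ ∃ j, j ≠ i ∧ (ω i, ω j) ∈ A} =
      MeasurableEquiv.piFinSuccAbove (fun _ => α) i ⁻¹'
        {q : α × (Fin m → α) | q.1 ∈ D ∧ ∃ j, (q.1, q.2 j) ∈ A} := by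
    ext ω
    simp only [Set.mem_ofPred_eq, Set.mem_preimage, MeasurableEquiv.piFinSuccAbove_apply]
    refine and_congr_right fun _ => ⟨?_, ?_⟩
    · rintro ⟨j, hj, h⟩
      obtain ⟨k, rfl⟩ := Fin.exists_succAbove_eq hj
      exact ⟨k, h⟩
    · rintro ⟨k, h⟩
      exact ⟨i.succAbove k, Fin.succAbove_ne i k, h⟩
  rw [hpre, (measurePreserving_piFinSuccAbove (fun _ => M) i).measure_preimage
    hset.nullMeasurableSet, Measure.prod_apply hset, mul_comm, ← setLIntegral_const]
  refine (setLIntegral_mono' hD fun a ha => ?_).trans (setLIntegral_le_lintegral D _)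
  have hcompl : Prod.mk a ⁻¹' {q : α × (Fin m → α) | q.1 ∈ D ∧ ∃ j, (q.1, q.2 j) ∈ A} =
      (Set.univ.pi fun _ : Fin m => {b | (a, b) ∈ A}ᶜ)ᶜ := by
    ext f
    simp [ha]
  rw [hcompl, prob_compl_eq_one_sub (MeasurableSet.univ_pi fun _ => (hsec a).compl),
    Measure.pi_pi]
  simp only [prob_compl_eq_one_sub (hsec a), Finset.prod_const, Finset.card_univ, Fintype.card_fin]
  gcongr
  exact hp a ha

/-- If exchanging two values of a permutation often keeps a fixed fraction of its weight, then
the permutations not sending `i` to `k` carry much of the total weight. -/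
theorem mul_sum_swap_weight_le {n : ℕ} (w : Equiv.Perm (Fin n) → ENNReal) (i k : Fin n)
    {c : ENNReal} (hc : c ≤ 1) (G : Set (Equiv.Perm (Fin n)))
    (hG : ∀ π ∈ G, ∃ j, j ≠ i ∧ c * w π ≤ w (π * Equiv.swap i j)) :
    c * ∑ π, G.indicator w π ≤ 2 * ∑ π, {π : Equiv.Perm (Fin n) | k ≠ π i}.indicator w π := by
  classical
  set W := ∑ π, {π : Equiv.Perm (Fin n) | k ≠ π i}.indicator w π with hW
  have hW' : W = ∑ π ∈ Finset.univ.filter (fun π : Equiv.Perm (Fin n) => k ≠ π i), w π := by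
    rw [Finset.sum_filter]
    exact Finset.sum_congr rfl fun π _ => by simp [Set.indicator_apply]
  have : Nonempty (Fin n) := ⟨i⟩
  choose! j hj hw using hG
  have h1 : ∑ π ∈ Finset.univ.filter (fun π => π ∈ G ∧ k = π i), c * w π ≤ W := by
    -- The exchange can be undone: since `π i = k`, the exchanged permutation sends `j π` to `k`, so
    -- it determines `j π` and hence `π`.
    have hinj : Set.InjOn (fun π => π * Equiv.swap i (j π))
        (Finset.univ.filter fun π : Equiv.Perm (Fin n) => π ∈ G ∧ k = π i : Finset _) := by
      intro π hπ ρ hρ h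
      simp only [Finset.coe_filter, Finset.mem_univ, true_and, Set.mem_ofPred_eq] at hπ hρ
      simp only at h
      have e1 : (π * Equiv.swap i (j π)) (j π) = k := by simp [hπ.2]
      have e2 : (π * Equiv.swap i (j π)) (j ρ) = k := by rw [h]; simp [hρ.2]
      have e3 : j π = j ρ := (π * Equiv.swap i (j π)).injective (e1.trans e2.symm)
      rw [e3] at h
      exact mul_right_cancel h
    calc _ ≤ ∑ π ∈ Finset.univ.filter (fun π => π ∈ G ∧ k = π i),
          w (π * Equiv.swap i (j π)) :=
          Finset.sum_le_sum fun π hπ => hw π (Finset.mem_filter.1 hπ).2.1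
      _ = ∑ π ∈ (Finset.univ.filter (fun π => π ∈ G ∧ k = π i)).image
          (fun π => π * Equiv.swap i (j π)), w π := (Finset.sum_image hinj).symm
      _ ≤ W := by
          rw [hW']
          refine Finset.sum_le_sum_of_subset fun ρ hρ => ?_
          obtain ⟨π, hπ, rfl⟩ := Finset.mem_image.1 hρ
          have h2 := (Finset.mem_filter.1 hπ).2
          refine Finset.mem_filter.2 ⟨Finset.mem_univ _, ?_⟩
          rw [h2.2, Equiv.Perm.mul_apply, Equiv.swap_apply_left]
          exact fun h => hj π h2.1 (π.injective h).symm
  have h2 : ∑ π ∈ Finset.univ.filter (fun π => π ∈ G ∧ k ≠ π i), c * w π ≤ W := by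
    rw [hW']
    calc _ ≤ ∑ π ∈ Finset.univ.filter (fun π => π ∈ G ∧ k ≠ π i), w π :=
          Finset.sum_le_sum fun π _ => mul_le_of_le_one_left zero_le hc
      _ ≤ _ := Finset.sum_le_sum_of_subset fun π hπ =>
          Finset.mem_filter.2 ⟨Finset.mem_univ _, (Finset.mem_filter.1 hπ).2.2⟩
  calc c * ∑ π, G.indicator w π
      = ∑ π ∈ Finset.univ.filter (fun π => π ∈ G ∧ k = π i), c * w π +
        ∑ π ∈ Finset.univ.filter (fun π => π ∈ G ∧ k ≠ π i), c * w π := by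
        rw [Finset.mul_sum, Finset.sum_filter, Finset.sum_filter, ← Finset.sum_add_distrib]
        refine Finset.sum_congr rfl fun π _ => ?_
        by_cases hπ : π ∈ G <;> by_cases hk : k = π i <;> simp [hπ, hk]
    _ ≤ 2 * W := by rw [two_mul]; exact add_le_add h1 h2

/-! ### Likelihoods and the exchange of two indices. -/

/-- The joint density of `n` independent vectors with law `𝒩(0, s² I_d)`. -/
noncomputable def configPDF {n d : ℕ} (s : ℝ) (z : PointConfig n d) : ℝ :=
  ∏ k, isoGaussianPDF d s (z k)

@[fun_prop]
theorem continuous_configPDF {n d : ℕ} (s : ℝ) :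
    Continuous (configPDF s : PointConfig n d → ℝ) := by
  unfold configPDF
  exact continuous_finsetProd _ fun k _ =>
    (continuous_isoGaussianPDF d s).comp (continuous_apply k)

theorem configPDF_eq {n d : ℕ} (s : ℝ) (z : PointConfig n d) :
    configPDF s z = (((Real.sqrt (2 * Real.pi) * s) ^ d)⁻¹) ^ n *
      Real.exp (-(∑ k, ‖z k‖ ^ 2) / (2 * s ^ 2)) := by
  unfold configPDF isoGaussianPDF
  rw [Finset.prod_mul_distrib, ← Real.exp_sum, ← Finset.sum_div, Finset.sum_neg_distrib]
  simp

/-- Translation by `X ∘ π` turns noise into data. Every `π` then gives an integral over the same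
`Y`, so likelihoods can be compared pointwise. -/
theorem pi_isoGaussian_observed_mem {n d : ℕ} {s : ℝ} (hs : 0 < s) (π : Equiv.Perm (Fin n))
    (X : PointConfig n d) {B : Set (PointConfig n d)} (hB : MeasurableSet B) :
    (Measure.pi fun _ : Fin n => isoGaussian d s) {Z | observed π X Z ∈ B} =
      ∫⁻ Y, B.indicator (fun Y => ENNReal.ofReal (configPDF s (Y - X ∘ π))) Y := by
  have hobs : Measurable fun Z : PointConfig n d => observed π X Z := by
    unfold observed; fun_prop
  have hpi : (Measure.pi fun _ : Fin n => isoGaussian d s) =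
      (volume : Measure (PointConfig n d)).withDensity
        fun z => ENNReal.ofReal (configPDF s z) := by
    rw [isoGaussian_eq_withDensity d hs, Measure.pi_withDensity_ofReal
      (integrable_isoGaussianPDF d hs) fun x => (isoGaussianPDF_pos hs x).le]
    rfl
  have hB' : MeasurableSet {Z : PointConfig n d | observed π X Z ∈ B} := hobs hB
  rw [hpi, withDensity_apply _ hB', ← lintegral_indicator hB',
    ← lintegral_add_right_eq_self (B.indicator _) (X ∘ π)]
  refine lintegral_congr fun Z => ?_
  have : observed π X Z = Z + X ∘ π := by
    funext k; simp [observed, add_comm]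
  rw [← this]
  by_cases h : observed π X Z ∈ B
  · rw [Set.indicator_of_mem h, Set.indicator_of_mem (show Z ∈ {Z | observed π X Z ∈ B} from h),
      this, add_sub_cancel_right]
  · rw [Set.indicator_of_notMem h,
      Set.indicator_of_notMem (show Z ∉ {Z | observed π X Z ∈ B} from h)]

/-- A Bayes argument without conditional laws: for fixed `X` and `Y` the estimator names a single
`k`, and `mul_sum_swap_weight_le` applies to the likelihoods of all `π` before integrating over `Y`.
-/
theorem mul_sum_prob_swap_le {n d : ℕ} {s : ℝ} (hs : 0 < s) (est : Estimator n d)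
    (X : PointConfig n d) (i : Fin n) {c : ℝ} (h0 : 0 ≤ c) (h1 : c ≤ 1) :
    ENNReal.ofReal c * ∑ π : Equiv.Perm (Fin n), (Measure.pi fun _ : Fin n => isoGaussian d s)
        {Z | ∃ j, j ≠ i ∧
          c * configPDF s Z ≤ configPDF s (observed π X Z - X ∘ (π * Equiv.swap i j))} ≤
      2 * ∑ π : Equiv.Perm (Fin n), (Measure.pi fun _ : Fin n => isoGaussian d s)
        {Z | (X, Z) ∈ errorEvent est π i} := by
  set G : Equiv.Perm (Fin n) → Set (PointConfig n d) := fun π => {Y | ∃ j, j ≠ i ∧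
    c * configPDF s (Y - X ∘ π) ≤ configPDF s (Y - X ∘ (π * Equiv.swap i j))} with hGdef
  set B : Equiv.Perm (Fin n) → Set (PointConfig n d) := fun π => {Y | est.toFun X Y i ≠ π i}
  have hG : ∀ π, MeasurableSet (G π) := by
    intro π
    simp only [hGdef, Set.ofPred_exists]
    refine MeasurableSet.iUnion fun j => ?_
    rw [Set.ofPred_and]
    refine (MeasurableSet.const _).inter (measurableSet_le ?_ ?_)
    · exact ((continuous_configPDF s).measurable.comp (measurable_id.sub_const _)).const_mul c
    · exact (continuous_configPDF s).measurable.comp (measurable_id.sub_const _)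
  have hB : ∀ π, MeasurableSet (B π) := fun π =>
    (est.measurable_toFun.comp measurable_prodMk_left)
      (MeasurableSet.of_discrete (s := {ρ : Equiv.Perm (Fin n) | ρ i ≠ π i}))
  have hZ : ∀ π (Z : PointConfig n d), observed π X Z - X ∘ π = Z := by
    intro π Z; funext k; simp [observed]
  have e1 : ∀ π : Equiv.Perm (Fin n), {Z | ∃ j, j ≠ i ∧
      c * configPDF s Z ≤ configPDF s (observed π X Z - X ∘ (π * Equiv.swap i j))} =
      {Z | observed π X Z ∈ G π} := by
    intro π; ext Z; simp only [hGdef, Set.mem_ofPred_eq, hZ]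
  have e2 : ∀ π : Equiv.Perm (Fin n), {Z | (X, Z) ∈ errorEvent est π i} =
      {Z | observed π X Z ∈ B π} := fun π => rfl
  have hmeas : ∀ π : Equiv.Perm (Fin n), Measurable fun Y : PointConfig n d =>
      ENNReal.ofReal (configPDF s (Y - X ∘ π)) := fun π =>
    ((continuous_configPDF s).measurable.comp (measurable_id.sub_const _)).ennreal_ofReal
  rw [Finset.sum_congr rfl fun π _ => (congrArg _ (e1 π)).trans
      (pi_isoGaussian_observed_mem hs π X (hG π)),
    Finset.sum_congr rfl fun π _ => (congrArg _ (e2 π)).trans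
      (pi_isoGaussian_observed_mem hs π X (hB π))]
  rw [← lintegral_finsetSum _ fun π _ => (hmeas π).indicator (hG π),
    ← lintegral_finsetSum _ fun π _ => (hmeas π).indicator (hB π),
    ← lintegral_const_mul _ (Finset.measurable_sum _ fun π _ => (hmeas π).indicator (hG π)),
    ← lintegral_const_mul _ (Finset.measurable_sum _ fun π _ => (hmeas π).indicator (hB π))]
  refine lintegral_mono fun Y => ?_
  refine mul_sum_swap_weight_le (fun π => ENNReal.ofReal (configPDF s (Y - X ∘ π))) i
    (est.toFun X Y i) (ENNReal.ofReal_le_one.2 h1) {π | Y ∈ G π} ?_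
  rintro π ⟨j, hj, h⟩
  refine ⟨j, hj, ?_⟩
  rw [← ENNReal.ofReal_mul h0]
  exact ENNReal.ofReal_le_ofReal h

open scoped RealInnerProductSpace in
theorem sum_sq_norm_observed_sub_swap {n d : ℕ} (π : Equiv.Perm (Fin n)) (X Z : PointConfig n d)
    {i j : Fin n} (hij : j ≠ i) :
    ∑ k, ‖(observed π X Z - X ∘ (π * Equiv.swap i j)) k‖ ^ 2 =
      ∑ k, ‖Z k‖ ^ 2 + 2 * (⟪Z i - Z j, X (π i) - X (π j)⟫ + ‖X (π i) - X (π j)‖ ^ 2) := by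
  rw [← sub_eq_iff_eq_add', ← Finset.sum_sub_distrib,
    ← Finset.sum_subset (Finset.subset_univ {i, j}), Finset.sum_pair hij.symm]
  · simp only [observed, Pi.sub_apply, Function.comp_apply, Equiv.Perm.mul_apply,
      Equiv.swap_apply_left, Equiv.swap_apply_right]
    rw [show X (π i) + Z i - X (π j) = Z i + (X (π i) - X (π j)) by abel,
      show X (π j) + Z j - X (π i) = Z j - (X (π i) - X (π j)) by abel,
      inner_sub_left]
    generalize X (π i) - X (π j) = V
    rw [norm_add_sq_real, norm_sub_sq_real]
    ring
  · intro k _ hk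
    simp only [Finset.mem_insert, Finset.mem_singleton, not_or] at hk
    simp [observed, Equiv.swap_apply_of_ne_of_ne hk.1 hk.2]

-- The exponent drops by `(⟪Z i - Z j, V⟫ + ‖V‖²) / s²` with `V = X (π i) - X (π j)`; Cauchy–Schwarz
-- bounds the two terms by `2 d` and `d`.
open scoped RealInnerProductSpace in
theorem exp_mul_configPDF_le_swap {n d : ℕ} {s τ : ℝ} (hs : 0 < s) (hτ : τ ≤ s)
    (π : Equiv.Perm (Fin n)) (X Z : PointConfig n d) {i j : Fin n} (hij : j ≠ i)
    (hi : ‖Z i‖ ≤ s * Real.sqrt d) (hj : ‖Z j‖ ≤ s * Real.sqrt d)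
    (hX : ‖X (π i) - X (π j)‖ ≤ τ * Real.sqrt d) :
    Real.exp (-3 * d) * configPDF s Z ≤
      configPDF s (observed π X Z - X ∘ (π * Equiv.swap i j)) := by
  rw [configPDF_eq, configPDF_eq, sum_sq_norm_observed_sub_swap π X Z hij, mul_left_comm,
    ← Real.exp_add]
  refine mul_le_mul_of_nonneg_left (Real.exp_le_exp.2 ?_) (by positivity)
  set V := X (π i) - X (π j)
  have hX' : ‖V‖ ≤ s * Real.sqrt d := hX.trans (by gcongr)
  have hd : Real.sqrt d * Real.sqrt d = d := Real.mul_self_sqrt (by positivity)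
  have h1 : ⟪Z i - Z j, V⟫ ≤ (2 * (s * Real.sqrt d)) * (s * Real.sqrt d) := by
    refine (real_inner_le_norm _ _).trans (mul_le_mul ?_ hX' (norm_nonneg _) (by positivity))
    exact (norm_sub_le _ _).trans (by linarith)
  have h2 : ‖V‖ ^ 2 ≤ (s * Real.sqrt d) ^ 2 := pow_le_pow_left₀ (norm_nonneg _) hX' 2
  have h3 : ⟪Z i - Z j, V⟫ + ‖V‖ ^ 2 ≤ 3 * d * s ^ 2 := by
    nlinarith
  have hs2 : 0 < s ^ 2 := by positivity
  rw [neg_add, add_div, show -(2 * (⟪Z i - Z j, V⟫ + ‖V‖ ^ 2)) / (2 * s ^ 2) =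
    -((⟪Z i - Z j, V⟫ + ‖V‖ ^ 2) / s ^ 2) by field_simp]
  have h4 : (⟪Z i - Z j, V⟫ + ‖V‖ ^ 2) / s ^ 2 ≤ 3 * d := (div_le_iff₀ hs2).2 h3
  linarith

theorem measurePreserving_comp_perm {n : ℕ} {α : Type*} [MeasurableSpace α] (P : Measure α)
    [SigmaFinite P] (π : Equiv.Perm (Fin n)) :
    MeasurePreserving (fun X : Fin n → α => X ∘ π) (Measure.pi fun _ => P)
      (Measure.pi fun _ => P) :=
  measurePreserving_arrowCongr' (fun _ : Fin n => P) (fun _ : Fin n => P) π.symm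
    (MeasurableEquiv.refl α) fun _ => MeasurePreserving.id P

/-! ### Probability of a close pair, and the risk bound it implies. -/

/-- The points `X (π i)` and `X (π j)` are within `τ √d` of each other for some `j ≠ i`, with
`X (π i)`, `Z i` and `Z j` of typical size. -/
def closePairEvent {n d : ℕ} (s τ : ℝ) (π : Equiv.Perm (Fin n)) (i : Fin n) :
    Set (PointConfig n d × PointConfig n d) :=
  {p | (‖p.1 (π i)‖ ≤ Real.sqrt d ∧ ‖p.2 i‖ ≤ s * Real.sqrt d) ∧
    ∃ j, j ≠ i ∧ ‖p.1 (π i) - p.1 (π j)‖ ≤ τ * Real.sqrt d ∧ ‖p.2 j‖ ≤ s * Real.sqrt d}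

theorem measurableSet_closePairEvent {n d : ℕ} (s τ : ℝ) (π : Equiv.Perm (Fin n)) (i : Fin n) :
    MeasurableSet (closePairEvent s τ π i : Set (PointConfig n d × PointConfig n d)) := by
  simp only [closePairEvent, Set.ofPred_and, Set.ofPred_exists]
  refine ((measurableSet_le (by fun_prop) (by fun_prop)).inter
    (measurableSet_le (by fun_prop) (by fun_prop))).inter (MeasurableSet.iUnion fun j => ?_)
  exact (MeasurableSet.const (j ≠ i)).inter
    ((measurableSet_le (by fun_prop) (by fun_prop)).inter
      (measurableSet_le (by fun_prop) (by fun_prop)))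

theorem isoGaussian_closedBall_zero_ge {d : ℕ} {s : ℝ} (hs : 0 < s) :
    ENNReal.ofReal ((1 / 10) ^ d) ≤
      isoGaussian d s (Metric.closedBall 0 (s * Real.sqrt d)) := by
  have h := isoGaussian_closedBall_ge (d := d) (x := 0) hs zero_le_one le_rfl
    (by rw [norm_zero]; positivity)
  rwa [one_mul] at h

/-- Relabelling `X` preserves its law, so `π = 1` suffices. The pairs `(X j, Z j)` are then i.i.d.,
and each constant `1 / 100` is a product of two ball estimates with constant `1 / 10`. -/
theorem prob_closePairEvent_ge {m d : ℕ} {s τ : ℝ} (hs : 0 < s) (h0 : 0 ≤ τ) (h1 : τ ≤ 1)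
    (π : Equiv.Perm (Fin (m + 1))) (i : Fin (m + 1)) :
    ENNReal.ofReal ((1 / 100) ^ d * (1 - (1 - (τ / 100) ^ d) ^ m)) ≤
      ((Measure.pi fun _ : Fin (m + 1) => isoGaussian d 1).prod
        (Measure.pi fun _ : Fin (m + 1) => isoGaussian d s)) (closePairEvent s τ π i) := by
  set M := (isoGaussian d 1).prod (isoGaussian d s)
  set D : Set (EuclideanSpace ℝ (Fin d) × EuclideanSpace ℝ (Fin d)) :=
    {a | ‖a.1‖ ≤ Real.sqrt d ∧ ‖a.2‖ ≤ s * Real.sqrt d}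
  set A : Set ((EuclideanSpace ℝ (Fin d) × EuclideanSpace ℝ (Fin d)) ×
      EuclideanSpace ℝ (Fin d) × EuclideanSpace ℝ (Fin d)) :=
    {q | ‖q.1.1 - q.2.1‖ ≤ τ * Real.sqrt d ∧ ‖q.2.2‖ ≤ s * Real.sqrt d}
  have hD : MeasurableSet D := by
    simp only [D, Set.ofPred_and]
    exact (measurableSet_le (by fun_prop) (by fun_prop)).inter
      (measurableSet_le (by fun_prop) (by fun_prop))
  have hA : MeasurableSet A := by
    simp only [A, Set.ofPred_and]
    exact (measurableSet_le (by fun_prop) (by fun_prop)).inter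
      (measurableSet_le (by fun_prop) (by fun_prop))
  have hp1 : (τ / 100) ^ d ≤ 1 := pow_le_one₀ (by positivity) (by linarith)
  have hMD : ENNReal.ofReal ((1 / 100) ^ d) ≤ M D := by
    have : D = Metric.closedBall 0 (1 * Real.sqrt d) ×ˢ Metric.closedBall 0 (s * Real.sqrt d) := by
      ext a; simp [D]
    rw [this, Measure.prod_prod, show (1 / 100 : ℝ) ^ d = (1 / 10) ^ d * (1 / 10) ^ d by
      rw [← mul_pow]; norm_num, ENNReal.ofReal_mul (by positivity)]
    exact mul_le_mul' (isoGaussian_closedBall_zero_ge one_pos) (isoGaussian_closedBall_zero_ge hs)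
  have hMA : ∀ a ∈ D, ENNReal.ofReal ((τ / 100) ^ d) ≤ M {b | (a, b) ∈ A} := by
    intro a ha
    have : {b | (a, b) ∈ A} =
        Metric.closedBall a.1 (τ * 1 * Real.sqrt d) ×ˢ Metric.closedBall 0 (s * Real.sqrt d) := by
      ext b; simp [A, dist_comm b.1, dist_eq_norm]
    rw [this, Measure.prod_prod, show (τ / 100 : ℝ) ^ d = (τ / 10) ^ d * (1 / 10) ^ d by
      rw [← mul_pow]; congr 1; ring, ENNReal.ofReal_mul (by positivity)]
    exact mul_le_mul' (isoGaussian_closedBall_ge one_pos h0 h1 (by rw [one_mul]; exact ha.1))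
      (isoGaussian_closedBall_zero_ge hs)
  have hpre : closePairEvent s τ π i =
      Prod.map (fun X : PointConfig (m + 1) d => X ∘ π) id ⁻¹'
        (closePairEvent s τ 1 i : Set (PointConfig (m + 1) d × PointConfig (m + 1) d)) := rfl
  have hP : SFinite (Measure.pi fun _ : Fin (m + 1) => isoGaussian d 1) := inferInstance
  have hQ : SFinite (Measure.pi fun _ : Fin (m + 1) => isoGaussian d s) := inferInstance
  have hmp := @MeasurePreserving.prod _ _ _ _ _ _ _ _ _ _ _ _ hP hQ _ _
    (measurePreserving_comp_perm (isoGaussian d 1) π)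
    (MeasurePreserving.id (Measure.pi fun _ : Fin (m + 1) => isoGaussian d s))
  have hm := measurableSet_closePairEvent (d := d) s τ 1 i
  rw [hpre, hmp.measure_preimage hm.nullMeasurableSet,
    ← (measurePreserving_arrowProdEquivProdArrow _ _ (Fin (m + 1)) (fun _ => isoGaussian d 1)
      fun _ => isoGaussian d s).measure_preimage hm.nullMeasurableSet]
  refine le_trans ?_ (Measure.pi_exists_rel_ge M i hD hA hMA)
  rw [ENNReal.ofReal_mul (by positivity),
    ENNReal.ofReal_sub _ (pow_nonneg (by linarith) _), ENNReal.ofReal_pow (sub_nonneg.2 hp1),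
    ENNReal.ofReal_sub _ (by positivity), ENNReal.ofReal_one]
  gcongr

theorem mul_sum_prob_closePairEvent_le {n d : ℕ} {s τ : ℝ} (hs : 0 < s) (hτ : τ ≤ s)
    (est : Estimator n d) (i : Fin n) :
    ENNReal.ofReal (Real.exp (-3 * d)) * ∑ π : Equiv.Perm (Fin n),
        ((Measure.pi fun _ : Fin n => isoGaussian d 1).prod
          (Measure.pi fun _ : Fin n => isoGaussian d s)) (closePairEvent s τ π i) ≤
      2 * ∑ π : Equiv.Perm (Fin n), ((Measure.pi fun _ : Fin n => isoGaussian d 1).prod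
          (Measure.pi fun _ : Fin n => isoGaussian d s)) (errorEvent est π i) := by
  rw [Finset.sum_congr rfl fun π _ => Measure.prod_apply (measurableSet_closePairEvent s τ π i),
    Finset.sum_congr rfl fun π _ => Measure.prod_apply (measurableSet_errorEvent est π i),
    ← lintegral_finsetSum _ fun π _ =>
      measurable_measure_prodMk_left (measurableSet_closePairEvent s τ π i),
    ← lintegral_finsetSum _ fun π _ =>
      measurable_measure_prodMk_left (measurableSet_errorEvent est π i),
    ← lintegral_const_mul _ (Finset.measurable_sum _ fun π _ =>
      measurable_measure_prodMk_left (measurableSet_closePairEvent s τ π i)),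
    ← lintegral_const_mul _ (Finset.measurable_sum _ fun π _ =>
      measurable_measure_prodMk_left (measurableSet_errorEvent est π i))]
  refine lintegral_mono fun X => ?_
  refine le_trans ?_ (mul_sum_prob_swap_le hs est X i (Real.exp_pos (-3 * d)).le
    (Real.exp_le_one_iff.2 (by linarith [Nat.cast_nonneg (α := ℝ) d])))
  gcongr with π _
  rintro Z ⟨⟨-, hi⟩, j, hj, hX, hZj⟩
  exact ⟨j, hj, exp_mul_configPDF_le_swap hs hτ π X Z hj hi hZj hX⟩

/-- Use `(1 - p)^m ≤ exp (-m p) ≤ 1 / (1 + m p)` and `x / (1 + x) ≥ min 1 x / 2`. -/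
theorem min_one_mul_div_two_le_one_sub_pow {p : ℝ} (h0 : 0 ≤ p) (h1 : p ≤ 1) (m : ℕ) :
    min 1 (m * p) / 2 ≤ 1 - (1 - p) ^ m := by
  have h2 : (1 - p) ^ m ≤ Real.exp (-(m * p)) := by
    calc (1 - p) ^ m ≤ Real.exp (-p) ^ m :=
          pow_le_pow_left₀ (by linarith) (Real.one_sub_le_exp_neg p) m
      _ = _ := by rw [← Real.exp_nat_mul]; congr 1; ring
  have hmp : 0 ≤ m * p := by positivity
  have h3 : Real.exp (-(m * p)) ≤ 1 / (1 + m * p) := by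
    rw [Real.exp_neg, ← one_div]
    exact one_div_le_one_div_of_le (by positivity) (by linarith [Real.add_one_le_exp (m * p)])
  have h4 : min 1 (m * p) / 2 ≤ 1 - 1 / (1 + m * p) := by
    rw [show 1 - 1 / (1 + m * p) = m * p / (1 + m * p) by field_simp; ring,
      div_le_div_iff₀ (by norm_num) (by positivity)]
    rcases le_total 1 (m * p) with h | h
    · rw [min_eq_left h]; linarith
    · rw [min_eq_right h]; nlinarith
  linarith

theorem risk_isoGaussian_ge {m d : ℕ} {s τ : ℝ} (hs : 0 < s) (h0 : 0 ≤ τ) (h1 : τ ≤ 1)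
    (hτ : τ ≤ s) (est : Estimator (m + 1) d) :
    (m + 1) * Real.exp (-3 * d) * ((1 / 100) ^ d * (1 - (1 - (τ / 100) ^ d) ^ m)) / 2 ≤
      risk (isoGaussian d 1) (isoGaussian d s) est := by
  have hp1 : (τ / 100) ^ d ≤ 1 := pow_le_one₀ (by positivity) (by linarith)
  set q := (1 / 100) ^ d * (1 - (1 - (τ / 100) ^ d) ^ m) with hq
  have hq0 : 0 ≤ q := mul_nonneg (by positivity)
    (sub_nonneg.2 (pow_le_one₀ (by linarith) (by linarith [show 0 ≤ (τ / 100) ^ d by positivity])))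
  rw [div_le_iff₀ two_pos, ← ENNReal.ofReal_le_ofReal_iff (mul_nonneg (risk_nonneg _ _ _) two_pos.le),
    ENNReal.ofReal_mul (risk_nonneg _ _ _), ofReal_risk, ← Finset.sum_mul, Finset.sum_comm]
  set N := Fintype.card (Equiv.Perm (Fin (m + 1)))
  have hN : (N : ENNReal) * (N : ENNReal)⁻¹ = 1 :=
    ENNReal.mul_inv_cancel (by simp [N, Fintype.card_ne_zero]) (by simp)
  have key : ∀ i : Fin (m + 1), ENNReal.ofReal (Real.exp (-3 * d)) * (N * ENNReal.ofReal q) ≤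
      2 * ∑ π : Equiv.Perm (Fin (m + 1)),
        ((Measure.pi fun _ : Fin (m + 1) => isoGaussian d 1).prod
          (Measure.pi fun _ : Fin (m + 1) => isoGaussian d s)) (errorEvent est π i) := by
    intro i
    refine le_trans ?_ (mul_sum_prob_closePairEvent_le hs hτ est i)
    gcongr
    calc (N : ENNReal) * ENNReal.ofReal q
        = ∑ π : Equiv.Perm (Fin (m + 1)), ENNReal.ofReal q := by simp [N]
      _ ≤ _ := Finset.sum_le_sum fun π _ => prob_closePairEvent_ge hs h0 h1 π i
  have hsum := Finset.sum_le_sum fun i (_ : i ∈ Finset.univ) => key i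
  calc ENNReal.ofReal ((m + 1) * Real.exp (-3 * d) * q)
      = (∑ _i : Fin (m + 1), ENNReal.ofReal (Real.exp (-3 * d)) * (N * ENNReal.ofReal q)) *
        (N : ENNReal)⁻¹ := by
        rw [Finset.sum_const, Finset.card_univ, Fintype.card_fin, nsmul_eq_mul,
          ENNReal.ofReal_mul (by positivity), ENNReal.ofReal_mul (by positivity),
          show ((m + 1 : ℕ) : ENNReal) * (ENNReal.ofReal (Real.exp (-3 * d)) *
              (N * ENNReal.ofReal q)) * (N : ENNReal)⁻¹ =
            ((m + 1 : ℕ) : ENNReal) * ENNReal.ofReal (Real.exp (-3 * d)) *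
              ENNReal.ofReal q * (N * (N : ENNReal)⁻¹) by ring, hN, mul_one]
        congr 2
        rw [← ENNReal.ofReal_natCast]
        push_cast; rfl
    _ ≤ _ := mul_le_mul_left hsum _
    _ = _ := by rw [← Finset.mul_sum, ENNReal.ofReal_ofNat]; ring

/-! ### Two-sided bounds with factors `exp (±20 d)`, and the asymptotics. -/

theorem minRisk_isoGaussian_ge {n d : ℕ} (hn : 2 ≤ n) (hd : 0 < d) {s : ℝ} (hs : 0 < s) :
    Real.exp (-20 * d) * min (n : ℝ) (n ^ 2 * s ^ d) ≤
      minRisk n (isoGaussian d 1) (isoGaussian d s) := by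
  obtain ⟨m, rfl⟩ : ∃ m, n = m + 1 := ⟨n - 1, by omega⟩
  refine le_ciInf fun est => ?_
  -- The exchange needs `τ ≤ s` and the ball estimate needs `τ ≤ 1`. Nothing is lost for `s > 1`,
  -- where the target is capped at `n`.
  set τ := min s 1 with hτ
  have hτ0 : 0 < τ := lt_min hs one_pos
  have hτ1 : τ ≤ 1 := min_le_right _ _
  refine le_trans ?_ (risk_isoGaussian_ge hs hτ0.le hτ1 (min_le_left _ _) est)
  have hp1 : (τ / 100) ^ d ≤ 1 := pow_le_one₀ (by positivity) (by linarith)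
  have hpow := min_one_mul_div_two_le_one_sub_pow (p := (τ / 100) ^ d) (by positivity) hp1 m
  have hm1 : (1 : ℝ) ≤ m := by exact_mod_cast (by omega : 1 ≤ m)
  set u := min 1 ((m + 1 : ℝ) * s ^ d) with hu
  have hu0 : 0 ≤ u := le_min zero_le_one (by positivity)
  have h100 : (1 / 100 : ℝ) ^ d ≤ 1 := pow_le_one₀ (by norm_num) (by norm_num)
  have hmin : (1 / 100) ^ d * u / 2 ≤ min 1 (m * (τ / 100) ^ d) := by
    refine le_min ?_ ?_
    · have : u ≤ 1 := min_le_left _ _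
      have h0 : (0 : ℝ) ≤ (1 / 100) ^ d := by positivity
      nlinarith
    · have h2 : u ≤ (m + 1) * τ ^ d := by
        rcases le_total s 1 with h | h
        · rw [hτ, min_eq_left h]; exact min_le_right _ _
        · rw [hτ, min_eq_right h, one_pow]
          exact (min_le_left _ _).trans (by linarith)
      calc (1 / 100) ^ d * u / 2 ≤ (1 / 100) ^ d * ((2 * m) * τ ^ d) / 2 := by
            gcongr
            refine h2.trans ?_
            gcongr
            linarith
        _ = m * (τ / 100) ^ d := by rw [div_pow, div_pow, one_pow]; ring
  -- The 8 collects three factors 2: from `hmin`, from `hpow` and from the risk bound. Here `20 = 3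
  -- + 17` with `exp 17 ≥ 100 * 100 * 8`, and `d ≥ 1` lets `8^d` absorb the 8.
  have hconst : Real.exp (-20 * d) ≤ Real.exp (-3 * d) * ((1 / 100) ^ d * (1 / 100) ^ d) / 8 := by
    have h17 : (80000 : ℝ) ≤ Real.exp 17 := by
      have h2 : (2 : ℝ) ≤ Real.exp 1 := by linarith [Real.add_one_le_exp (1 : ℝ)]
      calc (80000 : ℝ) ≤ 2 ^ 17 := by norm_num
        _ ≤ Real.exp 1 ^ 17 := by gcongr
        _ = Real.exp 17 := by rw [← Real.exp_nat_mul]; norm_num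
    have h8 : (1 / 8 : ℝ) ^ d ≤ 1 / 8 := pow_le_of_le_one (by norm_num) (by norm_num) hd.ne'
    calc Real.exp (-20 * d) = Real.exp (-3 * d) * Real.exp (-17) ^ d := by
          rw [← Real.exp_nat_mul, ← Real.exp_add]; congr 1; ring
      _ ≤ Real.exp (-3 * d) * (1 / 80000) ^ d := by
          gcongr
          rw [Real.exp_neg, ← one_div]
          exact one_div_le_one_div_of_le (by norm_num) h17
      _ = Real.exp (-3 * d) * ((1 / 100) ^ d * (1 / 100) ^ d) * (1 / 8) ^ d := by
          rw [mul_assoc, ← mul_pow, ← mul_pow]; norm_num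
      _ ≤ Real.exp (-3 * d) * ((1 / 100) ^ d * (1 / 100) ^ d) * (1 / 8) := by gcongr
      _ = _ := by ring
  have hfac : min ((m + 1 : ℕ) : ℝ) (((m + 1 : ℕ) : ℝ) ^ 2 * s ^ d) = (m + 1) * u := by
    push_cast
    rw [hu, mul_min_of_nonneg _ _ (by positivity), mul_one]
    congr 1; ring
  rw [hfac]
  calc Real.exp (-20 * d) * ((m + 1) * u)
      ≤ Real.exp (-3 * d) * ((1 / 100) ^ d * (1 / 100) ^ d) / 8 * ((m + 1) * u) := by gcongr
    _ = (m + 1) * Real.exp (-3 * d) * ((1 / 100) ^ d * ((1 / 100) ^ d * u / 2 / 2)) / 2 := by ring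
    _ ≤ (m + 1) * Real.exp (-3 * d) * ((1 / 100) ^ d * (1 - (1 - (τ / 100) ^ d) ^ m)) / 2 := by
        gcongr
        linarith

theorem minRisk_isoGaussian_le_exp_mul {n d : ℕ} (hd : 0 < d) {s : ℝ} (hs : 0 < s) :
    minRisk n (isoGaussian d 1) (isoGaussian d s) ≤ Real.exp (20 * d) * (n ^ 2 * s ^ d) := by
  refine (minRisk_isoGaussian_le hs).trans ?_
  have h2 : (4 : ℝ) ≤ Real.exp 20 := by linarith [Real.add_one_le_exp (20 : ℝ)]
  have h3 : (2 : ℝ) ≤ 2 ^ d := le_self_pow₀ (by norm_num) hd.ne'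
  have h4 : (2 : ℝ) * 2 ^ d ≤ Real.exp (20 * d) := by
    calc (2 : ℝ) * 2 ^ d ≤ 2 ^ d * 2 ^ d := by gcongr
      _ = 4 ^ d := by rw [← mul_pow]; norm_num
      _ ≤ Real.exp 20 ^ d := by gcongr
      _ = _ := by rw [← Real.exp_nat_mul]; congr 1; ring
  calc 2 * n ^ 2 * (2 * s) ^ d = 2 * 2 ^ d * (n ^ 2 * s ^ d) := by rw [mul_pow]; ring
    _ ≤ _ := by gcongr

/-- In `Y_i = X_{π⋆(i)} + Z_i` with `X_i ∼ 𝒩(0, I_d)`, `Z_i ∼ 𝒩(0, σ² I_d)` and `d = o(log n)`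
(where `d` and `σ > 0` may depend on `n`), the least expected number of mistakes equals
`(n^(2 + o(1)) σ^d) ∧ n^(1 + o(1))` as `n → ∞`. -/
theorem proposition2p1 (d : ℕ → ℕ) (hd_pos : ∀ n, 0 < d n)
    (hd : (fun n : ℕ => (d n : ℝ)) =o[atTop] (fun n : ℕ => Real.log (n : ℝ)))
    (σ : ℕ → ℝ) (hσ : ∀ n, 0 < σ n) :
    ∃ a b : ℕ → ℝ, Tendsto a atTop (𝓝 0) ∧ Tendsto b atTop (𝓝 0) ∧
      ∀ᶠ n : ℕ in atTop,
        minRisk n (isoGaussian (d n) 1) (isoGaussian (d n) (σ n)) =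
          min ((n : ℝ) ^ (2 + a n) * σ n ^ d n) ((n : ℝ) ^ (1 + b n)) := by
  set R : ℕ → ℝ := fun n => minRisk n (isoGaussian (d n) 1) (isoGaussian (d n) (σ n))
  set t : ℕ → ℝ := fun n => (n : ℝ) ^ 2 * σ n ^ d n
  -- Chosen so that `exp (20 d) = n^δ` for `n ≥ 2`.
  set δ : ℕ → ℝ := fun n => 20 * (d n / Real.log n)
  have hδ0 : Tendsto δ atTop (𝓝 0) := by
    simpa using (hd.tendsto_div_nhds_zero).const_mul (20 : ℝ)
  have hlower : ∀ n, 2 ≤ n → Real.exp (-20 * d n) * min (n : ℝ) (t n) ≤ R n :=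
    fun n hn => minRisk_isoGaussian_ge hn (hd_pos n) (hσ n)
  have hupper : ∀ n, R n ≤ Real.exp (20 * d n) * t n :=
    fun n => minRisk_isoGaussian_le_exp_mul (hd_pos n) (hσ n)
  have hcard : ∀ n, R n ≤ n := fun n => minRisk_le_card _ _
  have hlog : ∀ n : ℕ, 2 ≤ n → 0 < Real.log n := fun n hn =>
    Real.log_pos (by exact_mod_cast hn)
  have hbound : ∀ (n : ℕ) (x y : ℝ), 2 ≤ n → 0 < x → 0 < y →
      Real.exp (-20 * d n) * y ≤ x → x ≤ Real.exp (20 * d n) * y →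
      ‖Real.log (x / y) / Real.log n‖ ≤ δ n := by
    intro n x y hn hx hy h1 h2
    have hl := hlog n hn
    rw [Real.norm_eq_abs, abs_div, abs_of_pos hl,
      show δ n = 20 * d n / Real.log n from (mul_div_assoc _ _ _).symm, div_le_div_iff_of_pos_right hl,
      abs_le, Real.log_le_iff_le_exp (by positivity), Real.le_log_iff_exp_le (by positivity),
      le_div_iff₀ hy, div_le_iff₀ hy]
    exact ⟨by rwa [← neg_mul], h2⟩
  have hrpow : ∀ (n : ℕ) (x y : ℝ), 2 ≤ n → 0 < x → 0 < y →
      (n : ℝ) ^ (Real.log (x / y) / Real.log n) = x / y := by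
    intro n x y hn hx hy
    have hn0 : (0 : ℝ) < n := by exact_mod_cast (by omega : 0 < n)
    rw [Real.rpow_def_of_pos hn0, mul_div_cancel₀ _ (hlog n hn).ne', Real.exp_log (by positivity)]
  have htpos : ∀ n, 2 ≤ n → 0 < t n := by
    intro n hn
    have hn0 : (0 : ℝ) < n := by exact_mod_cast (by omega : 0 < n)
    exact mul_pos (by positivity) (pow_pos (hσ n) _)
  have hRpos : ∀ n, 2 ≤ n → 0 < R n := by
    intro n hn
    have hn0 : (0 : ℝ) < n := by exact_mod_cast (by omega : 0 < n)
    exact (mul_pos (Real.exp_pos _) (lt_min hn0 (htpos n hn))).trans_le (hlower n hn)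
  -- The smaller of `t n` and `n` is corrected to equal `R n` exactly; the other term is left alone.
  -- As `R n ≤ n`, and `n < t n` in the second case, the uncorrected term never falls below `R n`.
  refine ⟨fun n => if t n ≤ n then Real.log (R n / t n) / Real.log n else 0,
    fun n => if t n ≤ n then 0 else Real.log (R n / n) / Real.log n, ?_, ?_, ?_⟩
  · refine squeeze_zero_norm' ?_ hδ0
    filter_upwards [eventually_ge_atTop 2] with n hn
    have hδn : 0 ≤ δ n := mul_nonneg (by norm_num) (div_nonneg (by positivity) (hlog n hn).le)
    split_ifs with h
    · refine hbound n _ _ hn (hRpos n hn) (htpos n hn) ?_ (hupper n)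
      simpa [min_eq_right h] using hlower n hn
    · simpa using hδn
  · refine squeeze_zero_norm' ?_ hδ0
    filter_upwards [eventually_ge_atTop 2] with n hn
    have hδn : 0 ≤ δ n := mul_nonneg (by norm_num) (div_nonneg (by positivity) (hlog n hn).le)
    have hn0 : (0 : ℝ) < n := by exact_mod_cast (by omega : 0 < n)
    split_ifs with h
    · simpa using hδn
    · refine hbound n _ _ hn (hRpos n hn) hn0 ?_ ?_
      · simpa [min_eq_left (not_le.1 h).le] using hlower n hn
      · refine (hcard n).trans (le_mul_of_one_le_left hn0.le (Real.one_le_exp (by positivity)))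
  · filter_upwards [eventually_ge_atTop 2] with n hn
    have hn0 : (0 : ℝ) < n := by exact_mod_cast (by omega : 0 < n)
    have htn := htpos n hn
    change R n = _
    by_cases h : t n ≤ n
    · simp only [if_pos h]
      rw [Real.rpow_add hn0, hrpow n _ _ hn (hRpos n hn) htn, Real.rpow_two, mul_right_comm,
        show (n : ℝ) ^ 2 * σ n ^ d n = t n from rfl, mul_div_cancel₀ _ htn.ne', add_zero,
        Real.rpow_one, min_eq_left (hcard n)]
    · simp only [if_neg h]
      rw [add_zero, Real.rpow_two, Real.rpow_add hn0, hrpow n _ _ hn (hRpos n hn) hn0,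
        Real.rpow_one, mul_div_cancel₀ _ hn0.ne',
        show (n : ℝ) ^ 2 * σ n ^ d n = t n from rfl,
        min_eq_right ((hcard n).trans (not_le.1 h).le)]
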